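/- Let $G$ be a finite undirected graph (parallel edges and loops are allowed), with vertex set $\tilde V$, edge set $E$ and two disjoint sets $S,T\subseteq\tilde V$ (inputs and outputs) of vertices of degree $1$; put $V=\tilde V\setminus(S\cup T)$. Let $c:E\to\{1,2,3,\dots\}$ be a capacity function, and attach to each edge $e$ the space $\mathbb C^{c_e}$ with its standard basis. For $u\in S\cup T$ let $e(u)$ be the edge at $u$. A tensor assignment $\mathcal T$ chooses for every $v\in V$ a tensor $\mathcal T_v\in\bigotimes_{h}\mathbb C^{c_{e(h)}}$, where $h$ runs over the ends of edges at $v$ (a loop has two ends at its vertex) and $e(h)$ is the edge of $h$. Contracting the network gives the linear map $$\beta(G,c;\mathcal T):\bigotimes_{u\in S}\mathbb C^{c_{e(u)}}\to\bigotimes_{u\in T}\mathbb C^{c_{e(u)}},\qquad \langle I_T|\beta(G,c;\mathcal T)|I_S\rangle=\sum_{W}\ \prod_{v\in V}\langle W|_v\,|\,\mathcal T_v\rangle,$$ where $W$ runs over all assignments of a basis index to each edge of $G$ that restrict to $I_S$ on the inputs and to $I_T$ on the outputs, and $W|_v$ is the list of the indices that $W$ gives to the edge ends at $v$. Let $\operatorname{QMF}(G,c)$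 be the maximum of $\operatorname{rank}\beta(G,c;\mathcal T)$ over all tensor assignments $\mathcal T$. An edge cut set is the set of all edges joining $\bar S$ to $\bar T$ for some partition $\tilde V=\bar S\sqcup\bar T$ with $S\subseteq\bar S$ and $T\subseteq\bar T$. Let $C$ be the minimum cardinality of an edge cut set (the classical min cut). If $d_{\min}$ is a natural number with $c_e\ge d_{\min}$ for every edge $e$, then $$\operatorname{QMF}(G,c)\ \ge\ d_{\min}^{\,C}.$$ -/

import Mathlib

/-- The ends of edges of the multigraph `G` that lie at the vertex `v`: one for each edge incident
to `v`, and a second one for each loop at `v`. -/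
def EdgeEnd {α β : Type*} (G : Graph α β) (v : α) : Type _ :=
  G.incidenceSet v ⊕ G.loopSet v

namespace EdgeEnd

variable {α β : Type*} {G : Graph α β} {v : α}

/-- The edge to which an end belongs. -/
def edge : EdgeEnd G v → G.edgeSet
  | .inl e => ⟨e.1, Graph.Inc.edge_mem e.2⟩
  | .inr e => ⟨e.1, Graph.IsLoopAt.edge_mem e.2⟩

instance [Finite G.edgeSet] : Finite (EdgeEnd G v) :=
  haveI : Finite (G.incidenceSet v) :=
    Set.Finite.subset (Set.toFinite G.edgeSet) (G.incidenceSet_subset_edgeSet v)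
  haveI : Finite (G.loopSet v) :=
    Set.Finite.subset (Set.toFinite (G.incidenceSet v)) (G.loopSet_subset_incidenceSet v)
  inferInstanceAs (Finite (G.incidenceSet v ⊕ G.loopSet v))

end EdgeEnd

/-- A finite undirected multigraph with two disjoint sets `S` (inputs) and `T` (outputs) of
vertices of degree one, the open ends of the graph. The vertices outside `S ∪ T` are the ones that
will carry tensors. -/
structure OpenGraph (α β : Type*) where
  /-- the underlying undirected multigraph -/
  graph : Graph α β
  /-- the inputs -/
  S : Set α
  /-- the outputs -/
  T : Set α
  finite_vertexSet : graph.vertexSet.Finite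
  finite_edgeSet : graph.edgeSet.Finite
  subset_left : S ⊆ graph.vertexSet
  subset_right : T ⊆ graph.vertexSet
  disjoint : Disjoint S T
  /-- inputs and outputs have degree one (a loop counts twice) -/
  degree_eq_one : ∀ u ∈ S ∪ T, Nat.card (EdgeEnd graph u) = 1

namespace OpenGraph

variable {α β : Type*} (N : OpenGraph α β)

/-- The vertices that are not open ends. -/
def internal : Set α := N.graph.vertexSet \ (N.S ∪ N.T)

noncomputable instance : Fintype N.graph.edgeSet := N.finite_edgeSet.fintype

noncomputable instance : Fintype N.S := (N.finite_vertexSet.subset N.subset_left).fintype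

noncomputable instance : Fintype N.T := (N.finite_vertexSet.subset N.subset_right).fintype

noncomputable instance : Fintype N.internal :=
  (N.finite_vertexSet.subset Set.sdiff_subset).fintype

/-! ### Cuts -/

/-- `C` is the set of edges between the two sides of a partition of the vertex set, with all inputs
on one side and all outputs on the other. -/
def IsEdgeCut (C : Set β) : Prop :=
  ∃ A B : Set α, A ∪ B = N.graph.vertexSet ∧ Disjoint A B ∧ N.S ⊆ A ∧ N.T ⊆ B ∧
    C = {e | ∃ u ∈ A, ∃ v ∈ B, N.graph.IsLink e u v}

/-- The classical min cut: the least cardinality of an edge cut set. -/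
noncomputable def minCut : ℕ :=
  sInf {n | ∃ C : Set β, N.IsEdgeCut C ∧ C.ncard = n}

/-- Edge cut sets exist, hence the minimum in `minCut` is attained. -/
theorem exists_isEdgeCut_ncard_eq_minCut : ∃ C : Set β, N.IsEdgeCut C ∧ C.ncard = N.minCut := by
  have h : {n | ∃ C : Set β, N.IsEdgeCut C ∧ C.ncard = n}.Nonempty := by
    refine ⟨_, _, ⟨N.S, N.graph.vertexSet \ N.S, Set.union_sdiff_cancel N.subset_left,
      Set.disjoint_sdiff_right, subset_rfl, ?_, rfl⟩, rfl⟩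
    exact fun x hx => ⟨N.subset_right hx, fun hS => Set.disjoint_left.1 N.disjoint hS hx⟩
  exact Nat.sInf_mem h

/-! ### Tensor networks; an edge `e` carries the space `ℂ ^ (c e)` with its standard basis -/

variable (c : β → ℕ)

/-- Multi-indices for all edges: a basis index for each edge. -/
abbrev EdgeIndex : Type _ := (e : N.graph.edgeSet) → Fin (c e)

/-- Multi-indices at `v`: a basis index for each edge end at `v`. They index the standard basis of
the tensor product of the spaces `ℂ ^ (c e)` over the edge ends at `v`. -/
abbrev LocalIndex (v : α) : Type _ := (h : EdgeEnd N.graph v) → Fin (c h.edge)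

/-- The portion of a multi-index for all edges that can be read at `v`. -/
def readAt {N : OpenGraph α β} {c : β → ℕ} (W : N.EdgeIndex c) (v : α) : N.LocalIndex c v :=
  fun h => W h.edge

/-- Multi-indices for the input edges. An input has just one edge end, so this indexes the standard
basis of the tensor product over `u ∈ S` of the spaces `ℂ ^ (c e(u))`, `e(u)` the edge at `u`. -/
abbrev InputIndex : Type _ := (u : N.S) → N.LocalIndex c u

/-- Multi-indices for the output edges. -/
abbrev OutputIndex : Type _ := (u : N.T) → N.LocalIndex c u

noncomputable instance : Fintype (N.EdgeIndex c) := Fintype.ofFinite _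

noncomputable instance (v : α) : Fintype (N.LocalIndex c v) := Fintype.ofFinite _

noncomputable instance : Fintype (N.InputIndex c) := Fintype.ofFinite _

noncomputable instance : Fintype (N.OutputIndex c) := Fintype.ofFinite _

/-- An assignment of a tensor, given by its coordinates in the standard basis, to each vertex that
is not an open end. -/
abbrev TensorAssignment : Type _ := (v : N.internal) → N.LocalIndex c v → ℂ

variable {c} in
open Classical in
/-- The matrix, in the standard bases, of the linear map from the input space to the output space
that is obtained by contracting the tensor network. -/
noncomputable def beta (𝒯 : N.TensorAssignment c) :
    Matrix (N.OutputIndex c) (N.InputIndex c) ℂ :=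
  fun J I => ∑ W : N.EdgeIndex c with
    (∀ u : N.S, readAt W (u : α) = I u) ∧ (∀ u : N.T, readAt W (u : α) = J u),
      ∏ v : N.internal, 𝒯 v (readAt W (v : α))

/-- The quantum max-flow: the maximal rank of `beta` over all tensor assignments. -/
noncomputable def quantumMaxFlow : ℕ :=
  sSup (Set.range fun 𝒯 : N.TensorAssignment c => (N.beta 𝒯).rank)

/-- The ranks are bounded and tensor assignments exist, hence the maximum is attained. -/
theorem exists_rank_beta_eq_quantumMaxFlow :
    ∃ 𝒯 : N.TensorAssignment c, (N.beta 𝒯).rank = N.quantumMaxFlow c := by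
  have h := Nat.sSup_mem (s := Set.range fun 𝒯 : N.TensorAssignment c => (N.beta 𝒯).rank)
    ⟨_, fun _ _ => 0, rfl⟩ ⟨Fintype.card (N.InputIndex c), by
      rintro _ ⟨𝒯, rfl⟩
      exact (N.beta 𝒯).rank_le_card_width⟩
  exact h

end OpenGraph

/-! Menger's theorem, applied to the line graph (`EdgeAdj`), yields as many pairwise disjoint edge
sets `F i` as the min cut, each containing a walk from the inputs to the outputs. Let every tensor
be the indicator of the local patterns in which each `F i` carries one common label and all other
edges carry 0. Consecutive edges of a walk share a vertex, so a label entering along `F i` must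
leave unchanged (`label_eq_of_readAt`). Restricted to labelled inputs and outputs, the contraction
is therefore diagonal with nonzero entries, one for each choice of `k` labels out of `d`.

Menger's theorem itself goes by induction on the number of arcs: delete an arc, and if a separator
`Z` becomes too small, glue families of walks on its two sides. -/

/-! ### Menger's theorem for relations on a finite type -/

namespace Menger

open Relation

variable {X : Type*} {r r' : X → X → Prop} {F F' A B Z : Set X} {a b x y z : X}

/-- There is an `r`-walk from `a` to `b` all of whose vertices lie in `F`. -/
def Reach (r : X → X → Prop) (F : Set X) (a b : X) : Prop :=
  a ∈ F ∧ ReflTransGen (fun x y => r x y ∧ x ∈ F ∧ y ∈ F) a b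

/-- There is an `r`-walk from `A` to `B` all of whose vertices lie in `F`. -/
def Connects (r : X → X → Prop) (F A B : Set X) : Prop :=
  ∃ a ∈ A, ∃ b ∈ B, Reach r F a b

theorem Reach.refl (h : a ∈ F) : Reach r F a a := ⟨h, .refl⟩

theorem Reach.left_mem (h : Reach r F a b) : a ∈ F := h.1

theorem Reach.right_mem (h : Reach r F a b) : b ∈ F := by
  obtain ⟨ha, h⟩ := h
  induction h with
  | refl => exact ha
  | tail _ h _ => exact h.2.2

theorem Reach.trans (h : Reach r F a b) (h' : Reach r F b z) : Reach r F a z :=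
  ⟨h.1, h.2.trans h'.2⟩

theorem Reach.tail (h : Reach r F a b) (hr : r b z) (hz : z ∈ F) : Reach r F a z :=
  ⟨h.1, h.2.tail ⟨hr, h.right_mem, hz⟩⟩

theorem Reach.mono (hr : ∀ x y, r x y → r' x y) (hF : F ⊆ F') (h : Reach r F a b) :
    Reach r' F' a b :=
  ⟨hF h.1, h.2.lift id fun _ _ h => ⟨hr _ _ h.1, hF h.2.1, hF h.2.2⟩⟩

theorem Reach.swap (h : Reach r F a b) : Reach (fun x y => r y x) F b a :=
  ⟨h.right_mem, (ReflTransGen.swap _ _ h.2).lift id fun _ _ h => ⟨h.1, h.2.2, h.2.1⟩⟩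

theorem Connects.mono (hr : ∀ x y, r x y → r' x y) (hF : F ⊆ F') (h : Connects r F A B) :
    Connects r' F' A B := by
  obtain ⟨a, ha, b, hb, h⟩ := h
  exact ⟨a, ha, b, hb, h.mono hr hF⟩

theorem Connects.swap (h : Connects r F A B) : Connects (fun x y => r y x) F B A := by
  obtain ⟨a, ha, b, hb, h⟩ := h
  exact ⟨b, hb, a, ha, h.swap⟩

theorem Reach.induction {p : X → Prop} (h : Reach r F a b) (ha : p a)
    (hstep : ∀ x y, Reach r F a x → r x y → y ∈ F → p x → p y) : p b := by
  obtain ⟨hF, h⟩ := h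
  induction h with
  | refl => exact ha
  | tail h h' ih => exact hstep _ _ ⟨hF, h⟩ h'.1 h'.2.2 ih

/-! ### Trimming walks at a separator -/

/-- The vertices of `F` that can be reached from `A` by walks in `F` that end as soon as they meet
`B`. -/
def trim (r : X → X → Prop) (F A B : Set X) : Set X :=
  {z ∈ F | z ∈ A ∨ ∃ a ∈ A, ∃ w, Reach r (F \ B) a w ∧ r w z}

theorem trim_subset : trim r F A B ⊆ F := fun _ h => h.1

theorem reach_trim (ha : a ∈ A) (h : Reach r (F \ B) a z) : Reach r (trim r F A B) a z := by
  refine h.induction (.refl ⟨h.left_mem.1, .inl ha⟩) fun x y hx hr hy ih => ?_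
  exact ih.tail hr ⟨hy.1, .inr ⟨a, ha, x, hx, hr⟩⟩

/-- Follow the walk up to its first vertex in `B`, if there is one. -/
theorem Reach.reach_diff_or_connects (ha : a ∈ A) (h : Reach r F a b) :
    Reach r (F \ B) a b ∨ Connects r (trim r F A B) A B := by
  have hstart : a ∈ trim r F A B := ⟨h.left_mem, .inl ha⟩
  refine h.induction (p := fun z => Reach r (F \ B) a z ∨ Connects r (trim r F A B) A B) ?_
    fun x y _ hr hy ih => ?_
  · by_cases hB : a ∈ B
    · exact .inr ⟨a, ha, a, hB, .refl hstart⟩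
    · exact .inl (.refl ⟨h.left_mem, hB⟩)
  · refine ih.elim (fun hx => ?_) .inr
    by_cases hB : y ∈ B
    · exact .inr ⟨a, ha, y, hB, (reach_trim ha hx).tail hr ⟨hy, .inr ⟨a, ha, x, hx, hr⟩⟩⟩
    · exact .inl (hx.tail hr ⟨hy, hB⟩)

theorem Connects.trim (h : Connects r F A B) : Connects r (trim r F A B) A B := by
  obtain ⟨a, ha, b, hb, h⟩ := h
  exact (h.reach_diff_or_connects ha).resolve_left fun h => h.right_mem.2 hb

/-- If `Z` separates `A` from `B`, then a set trimmed from `A` up to a superset of `Z` meets a set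
trimmed from `B` up to a superset of `Z` inside `Z` only. -/
theorem trim_inter_trim_subset {P Q : Set X} (hZ : ¬ Connects r Zᶜ A B) (hP : Z ⊆ P) (hQ : Z ⊆ Q) :
    trim r F A P ∩ trim (fun x y => r y x) F' B Q ⊆ Z := by
  rintro z ⟨⟨-, h₁⟩, ⟨-, h₂⟩⟩
  by_contra hz
  have h₁ : ∃ a ∈ A, Reach r Zᶜ a z := by
    obtain h | ⟨a, ha, w, hw, hr⟩ := h₁
    · exact ⟨z, h, .refl hz⟩
    · exact ⟨a, ha, (hw.mono (fun _ _ => id) fun v hv hvZ => hv.2 (hP hvZ)).tail hr hz⟩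
  have h₂ : ∃ b ∈ B, Reach (fun x y => r y x) Zᶜ b z := by
    obtain h | ⟨a, ha, w, hw, hr⟩ := h₂
    · exact ⟨z, h, .refl hz⟩
    · exact ⟨a, ha, (hw.mono (fun _ _ => id) fun v hv hvZ => hv.2 (hQ hvZ)).tail hr hz⟩
  obtain ⟨a, ha, h₁⟩ := h₁
  obtain ⟨b, hb, h₂⟩ := h₂
  exact hZ ⟨a, ha, b, hb, h₁.trans h₂.swap⟩

/-! ### Deletion of an arc -/

/-- The relation `r` without the arc from `x` to `y`. -/
def delete (r : X → X → Prop) (x y : X) : X → X → Prop := fun u v => r u v ∧ ¬ (u = x ∧ v = y)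

/-- If `Z` separates `A` from `B` after deletion of an arc `x → y`, then each set separating `A`
from `insert x Z` after the deletion separates `A` from `B` before the deletion. -/
theorem not_connects_of_not_connects_delete {Y : Set X} (hZ : ¬ Connects (delete r x y) Zᶜ A B)
    (hY : ¬ Connects (delete r x y) Yᶜ A (insert x Z)) : ¬ Connects r Yᶜ A B := by
  rintro ⟨a, ha, b, hb, h⟩
  -- The deleted arc starts at `x`, so a walk that has not yet met `insert x Z` has not used it.
  suffices h' : Reach (delete r x y) (Yᶜ ∩ (insert x Z)ᶜ) a b from
    hZ ⟨a, ha, b, hb, h'.mono (fun _ _ => id) fun v hv hvZ => hv.2 (.inr hvZ)⟩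
  refine h.induction (.refl ⟨h.left_mem, fun haP => hY ⟨a, ha, a, haP, .refl h.left_mem⟩⟩)
    fun u v _ hr hv ih => ?_
  have hd : delete r x y u v := ⟨hr, fun h => ih.right_mem.2 (.inl h.1)⟩
  refine ih.tail hd ⟨hv, fun hvP => hY ⟨a, ha, v, hvP, ?_⟩⟩
  exact (ih.mono (fun _ _ => id) Set.inter_subset_left).tail hd hv

theorem delete_swap : (fun u v => delete r x y v u) = delete (fun u v => r v u) y x := by
  funext u v
  simp only [delete, and_comm (a := v = x)]

theorem connects_swap : Connects (fun x y => r y x) F B A ↔ Connects r F A B :=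
  ⟨fun h => h.swap, fun h => h.swap⟩

theorem not_connects_insert (hZ : ¬ Connects (delete r x y) Zᶜ A B) :
    ¬ Connects r (insert x Z)ᶜ A B := by
  refine not_connects_of_not_connects_delete hZ ?_
  rintro ⟨a, -, b, hb, h⟩
  exact h.right_mem hb

variable [Finite X]

/-- A disjoint family indexed by as many indices as `P` has elements, whose members all meet `P`,
can be indexed by the elements of `P` that they contain. -/
theorem exists_reindex {n : ℕ} {P : Set X} (hP : P.ncard = n) (G : Fin n → Set X)
    (hd : Pairwise fun i j => Disjoint (G i) (G j)) (hG : ∀ i, ∃ p ∈ P, p ∈ G i) :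
    ∃ f : P ≃ Fin n, ∀ p : P, (p : X) ∈ G (f p) := by
  choose g hgP hg using hG
  have hinj : Function.Injective fun i => (⟨g i, hgP i⟩ : P) := by
    intro i j hij
    by_contra hne
    refine Set.disjoint_left.1 (hd hne) (hg i) ?_
    rw [show g i = g j from congrArg Subtype.val hij]
    exact hg j
  have hbij := (Nat.bijective_iff_injective_and_card _).2
    ⟨hinj, by rw [Nat.card_fin, Nat.card_coe_set_eq, hP]⟩
  refine ⟨(Equiv.ofBijective _ hbij).symm, fun p => ?_⟩
  have h : g ((Equiv.ofBijective _ hbij).symm p) = p :=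
    congrArg Subtype.val ((Equiv.ofBijective _ hbij).apply_symm_apply p)
  have h' := hg ((Equiv.ofBijective _ hbij).symm p)
  rwa [h] at h'

/-- There are `n` disjoint sets and `n` points of `P`, and each trimmed set meets `P`, so each
contains exactly one of these points, at which its walk must end. -/
theorem exists_reach_of_connects {n : ℕ} {P : Set X} (hP : P.ncard = n) (G : Fin n → Set X)
    (hd : Pairwise fun i j => Disjoint (G i) (G j)) (hG : ∀ i, Connects r (G i) A P) :
    ∃ H : X → Set X, (∀ p ∈ P, ∃ i, H p = trim r (G i) A P) ∧
      (∀ p ∈ P, ∀ q ∈ P, p ≠ q → Disjoint (H p) (H q)) ∧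
      (∀ p ∈ P, ∃ a ∈ A, Reach r (H p) a p) ∧ ∀ p ∈ P, ∀ q ∈ P, q ∈ H p → q = p := by
  classical
  have hd' : Pairwise fun i j => Disjoint (trim r (G i) A P) (trim r (G j) A P) :=
    fun i j hij => (hd hij).mono trim_subset trim_subset
  obtain ⟨f, hf⟩ := exists_reindex hP _ hd' fun i => by
    obtain ⟨a, -, b, hb, h⟩ := (hG i).trim
    exact ⟨b, hb, h.right_mem⟩
  have huniq : ∀ p q : P, (q : X) ∈ trim r (G (f p)) A P → q = p := fun p q hq => by
    by_contra hne
    exact Set.disjoint_left.1 (hd' fun h => hne (f.injective h)) (hf q) hq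
  refine ⟨fun p => if h : p ∈ P then trim r (G (f ⟨p, h⟩)) A P else ∅, fun p hp => ?_,
    fun p hp q hq hne => ?_, fun p hp => ?_, fun p hp q hq h => ?_⟩
  · exact ⟨_, dif_pos hp⟩
  · simp only [dif_pos hp, dif_pos hq]
    exact hd' fun h => hne (congrArg Subtype.val (f.injective h))
  · simp only [dif_pos hp]
    obtain ⟨a, ha, b, hb, h⟩ := (hG (f ⟨p, hp⟩)).trim
    have : b = p := congrArg Subtype.val (huniq ⟨p, hp⟩ ⟨b, hb⟩ h.right_mem)
    exact ⟨a, ha, this ▸ h⟩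
  · simp only [dif_pos hp] at h
    exact congrArg Subtype.val (huniq ⟨p, hp⟩ ⟨q, hq⟩ h)

/-- **Menger's theorem**: if each set that separates `A` from `B` has at least `n` elements, then
there are `n` disjoint sets that contain walks from `A` to `B`. -/
theorem exists_disjoint_connects (n : ℕ) (r : X → X → Prop) (A B : Set X)
    (h : ∀ Z : Set X, ¬ Connects r Zᶜ A B → n ≤ Z.ncard) :
    ∃ F : Fin n → Set X, (Pairwise fun i j => Disjoint (F i) (F j)) ∧
      ∀ i, Connects r (F i) A B := by
  classical
  induction hm : {p : X × X | r p.1 p.2}.ncard using Nat.strong_induction_on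
    generalizing r A B with
  | _ m ih =>
  by_cases harc : ∃ x y, r x y
  · obtain ⟨x, y, hxy⟩ := harc
    have hlt : {p : X × X | delete r x y p.1 p.2}.ncard < m := by
      rw [← hm]
      refine Set.ncard_lt_ncard ⟨fun p hp => hp.1, fun hsub => ?_⟩ (Set.toFinite _)
      exact (hsub (show (x, y) ∈ {p : X × X | r p.1 p.2} from hxy)).2 ⟨rfl, rfl⟩
    by_cases hsep : ∀ Z : Set X, ¬ Connects (delete r x y) Zᶜ A B → n ≤ Z.ncard
    · obtain ⟨F, hF, hc⟩ := ih _ hlt (delete r x y) A B hsep rfl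
      exact ⟨F, hF, fun i => (hc i).mono (fun _ _ h => h.1) subset_rfl⟩
    push Not at hsep
    -- Adding either end of the arc to `Z` gives a separator for `r`, so `Z` has exactly `n - 1`
    -- elements and contains neither end.
    obtain ⟨Z, hZ, hZn⟩ := hsep
    have hZ' : ¬ Connects (delete (fun u v => r v u) y x) Zᶜ B A := by
      rw [← delete_swap, connects_swap]
      exact hZ
    have hxn := h _ (not_connects_insert hZ)
    have hyn : n ≤ (insert y Z).ncard := by
      refine h _ ?_
      rw [← connects_swap]
      exact not_connects_insert hZ'
    have hcard : ∀ w, n ≤ (insert w Z).ncard → w ∉ Z ∧ (insert w Z).ncard = n := by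
      intro w hw
      have hwZ : w ∉ Z := fun hwZ => by
        rw [Set.insert_eq_of_mem hwZ] at hw
        omega
      refine ⟨hwZ, ?_⟩
      rw [Set.ncard_insert_of_notMem hwZ] at hw ⊢
      omega
    obtain ⟨hxZ, hxn⟩ := hcard x hxn
    obtain ⟨hyZ, hyn⟩ := hcard y hyn
    obtain ⟨F, hF, hFc⟩ := ih _ hlt (delete r x y) A (insert x Z)
      (fun Y hY => h Y (not_connects_of_not_connects_delete hZ hY)) rfl
    obtain ⟨G, hG, hGc⟩ := ih _ hlt (delete r x y) (insert y Z) B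
      (fun Y hY => h Y (by
        rw [← connects_swap]
        refine not_connects_of_not_connects_delete hZ' ?_
        rw [← delete_swap, connects_swap]
        exact hY)) rfl
    obtain ⟨H, hHt, hHd, hHr, hHu⟩ := exists_reach_of_connects hxn F hF hFc
    obtain ⟨K, hKt, hKd, hKr, hKu⟩ := exists_reach_of_connects hyn G hG fun i => (hGc i).swap
    have hHK : ∀ p ∈ insert x Z, ∀ q ∈ insert y Z, ∀ z ∈ H p, z ∈ K q → z ∈ Z ∧ z = p ∧ z = q := by
      intro p hp q hq z hzp hzq
      obtain ⟨i, hi⟩ := hHt p hp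
      obtain ⟨j, hj⟩ := hKt q hq
      have hz : z ∈ Z := trim_inter_trim_subset hZ (Set.subset_insert x Z) (Set.subset_insert y Z)
        ⟨hi ▸ hzp, hj ▸ hzq⟩
      exact ⟨hz, hHu p hp z (.inr hz) hzp, hKu q hq z (.inr hz) hzq⟩
    -- Gluing rule: walks ending and starting at the same point of `Z` are joined there; the one
    -- ending at `x` continues along the arc to `y`.
    set φ : X → X := fun p => if p = x then y else p with hφ
    have hφx : φ x = y := if_pos rfl
    have hφZ : ∀ p ∈ Z, φ p = p := fun p hp => if_neg fun h : p = x => hxZ (h ▸ hp)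
    have hφm : ∀ p ∈ insert x Z, φ p ∈ insert y Z := by
      rintro p (rfl | hp)
      · exact .inl hφx
      · exact .inr (by rwa [hφZ p hp])
    have hφi : ∀ p ∈ insert x Z, ∀ q ∈ insert x Z, φ p = φ q → p = q := by
      rintro p (rfl | hp) q (rfl | hq) hpq
      · rfl
      · rw [hφx, hφZ q hq] at hpq
        exact absurd (hpq ▸ hq) hyZ
      · rw [hφx, hφZ p hp] at hpq
        exact absurd (hpq ▸ hp) hyZ
      · rwa [hφZ p hp, hφZ q hq] at hpq
    have hmeet : ∀ p ∈ insert x Z, ∀ q ∈ insert x Z, p ≠ q → Disjoint (H p) (K (φ q)) := by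
      refine fun p hp q hq hne => Set.disjoint_left.2 fun z hzp hzq => hne ?_
      obtain ⟨hz, rfl, h₂⟩ := hHK p hp _ (hφm q hq) z hzp hzq
      exact hφi _ hp _ hq (by rw [hφZ z hz, ← h₂])
    have hcardx : Nat.card ↥(insert x Z) = Nat.card (Fin n) := by
      rw [Nat.card_fin, Nat.card_coe_set_eq, hxn]
    obtain ⟨f⟩ : Nonempty (Fin n ≃ ↥(insert x Z)) := (Finite.card_eq.1 hcardx).map Equiv.symm
    refine ⟨fun i => H (f i) ∪ K (φ (f i)), fun i j hij => ?_, fun i => ?_⟩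
    · have hne : (f i : X) ≠ f j := fun h => hij (f.injective (Subtype.ext h))
      refine Set.disjoint_union_left.2 ⟨Set.disjoint_union_right.2 ⟨?_, ?_⟩,
        Set.disjoint_union_right.2 ⟨?_, ?_⟩⟩
      · exact hHd _ (f i).2 _ (f j).2 hne
      · exact hmeet _ (f i).2 _ (f j).2 hne
      · exact (hmeet _ (f j).2 _ (f i).2 hne.symm).symm
      · exact hKd _ (hφm _ (f i).2) _ (hφm _ (f j).2) fun h =>
          hne (hφi _ (f i).2 _ (f j).2 h)
    · obtain ⟨a, ha, hra⟩ := hHr _ (f i).2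
      obtain ⟨b, hb, hrb⟩ := hKr _ (hφm _ (f i).2)
      have hra' := hra.mono (r' := r) (fun _ _ h => h.1) (Set.subset_union_left (t := K (φ (f i))))
      have hrb' := hrb.swap.mono (r' := r) (fun _ _ h => h.1)
        (Set.subset_union_right (s := H (f i)))
      refine ⟨a, ha, b, hb, Reach.trans ?_ hrb'⟩
      obtain hfx | hfZ := (f i).2
      · refine hra'.tail ?_ hrb'.left_mem
        rw [hfx, hφx]
        exact hxy
      · simpa only [hφZ _ hfZ] using hra'
  -- Without arcs every walk is a single point, so `A ∩ B` is a separator.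
  · push Not at harc
    have hn : n ≤ (A ∩ B).ncard := by
      refine h _ ?_
      rintro ⟨a, ha, b, hb, hab⟩
      have : a = b := hab.induction (p := fun z => a = z) rfl fun u v _ hr _ _ => absurd hr (harc u v)
      exact hab.left_mem ⟨ha, this.symm ▸ hb⟩
    have hle : Nat.card (Fin n) ≤ Nat.card ↥(A ∩ B) := by
      rwa [Nat.card_fin, Nat.card_coe_set_eq]
    obtain ⟨f⟩ : Nonempty (Fin n ↪ ↥(A ∩ B)) := by
      have := Fintype.ofFinite ↥(A ∩ B)
      refine Function.Embedding.nonempty_of_card_le ?_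
      simpa [Nat.card_eq_fintype_card] using hle
    refine ⟨fun i => {(f i : X)}, fun i j hij => ?_, fun i => ?_⟩
    · exact Set.disjoint_singleton.2 fun h => hij (f.injective (Subtype.ext h))
    · exact ⟨f i, (f i).2.1, f i, (f i).2.2, .refl rfl⟩

end Menger

/-! ### From the min cut to disjoint walks of edges -/

namespace OpenGraph

open Menger

variable {α β : Type*} (N : OpenGraph α β)

/-- Two edges are adjacent if they share a vertex. -/
def EdgeAdj (e e' : N.graph.edgeSet) : Prop :=
  ∃ v, N.graph.Inc (e : β) v ∧ N.graph.Inc (e' : β) v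

/-- The edges that are incident to a vertex in `U`. -/
def edgesAt (U : Set α) : Set N.graph.edgeSet :=
  {e | ∃ u ∈ U, N.graph.Inc (e : β) u}

theorem minCut_le_ncard {C : Set β} (hC : N.IsEdgeCut C) : N.minCut ≤ C.ncard :=
  Nat.sInf_le ⟨C, hC, rfl⟩

/-- The inputs and the vertices touched by edges reachable outside `Z` form one side of a cut. An
edge of this cut outside `Z` would itself be reachable, placing both its ends on that side. -/
theorem minCut_le_of_not_connects {Z : Set N.graph.edgeSet}
    (hZ : ¬ Connects N.EdgeAdj Zᶜ (N.edgesAt N.S) (N.edgesAt N.T)) : N.minCut ≤ Z.ncard := by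
  set A : Set α := {v ∈ N.graph.vertexSet | v ∈ N.S ∨
    ∃ e : N.graph.edgeSet, N.graph.Inc (e : β) v ∧ ∃ a ∈ N.edgesAt N.S, Reach N.EdgeAdj Zᶜ a e}
    with hA
  have hAV : A ⊆ N.graph.vertexSet := fun v hv => hv.1
  have hcut : N.IsEdgeCut {e | ∃ u ∈ A, ∃ v ∈ N.graph.vertexSet \ A, N.graph.IsLink e u v} := by
    refine ⟨A, N.graph.vertexSet \ A, Set.union_sdiff_cancel hAV, Set.disjoint_sdiff_right,
      fun s hs => ⟨N.subset_left hs, .inl hs⟩, fun t ht => ⟨N.subset_right ht, ?_⟩, rfl⟩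
    rintro ⟨-, hs | ⟨e, he, a, ha, hr⟩⟩
    · exact Set.disjoint_left.1 N.disjoint hs ht
    · exact hZ ⟨a, ha, e, ⟨t, ht, he⟩, hr⟩
  refine (N.minCut_le_ncard hcut).trans ?_
  rw [← Set.ncard_image_of_injective Z Subtype.val_injective]
  refine Set.ncard_le_ncard ?_ (Set.toFinite _)
  rintro e ⟨u, hu, v, hv, huv⟩
  by_contra he
  have heZ : (⟨e, huv.edge_mem⟩ : N.graph.edgeSet) ∈ Zᶜ := fun h => he ⟨_, h, rfl⟩
  refine hv.2 ⟨hv.1, .inr ⟨⟨e, huv.edge_mem⟩, huv.inc_right, ?_⟩⟩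
  obtain ⟨-, hs | ⟨e', he', a, ha, hr⟩⟩ := hu
  · exact ⟨_, ⟨u, hs, huv.inc_left⟩, .refl heZ⟩
  · exact ⟨a, ha, hr.tail ⟨u, he', huv.inc_left⟩ heZ⟩

/-- The edge version of Menger's theorem for open graphs. -/
theorem exists_disjoint_edge_sets : ∃ F : Fin N.minCut → Set N.graph.edgeSet,
    (Pairwise fun i j => Disjoint (F i) (F j)) ∧
      ∀ i, Connects N.EdgeAdj (F i) (N.edgesAt N.S) (N.edgesAt N.T) :=
  exists_disjoint_connects _ _ _ _ fun _ => N.minCut_le_of_not_connects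

theorem rank_beta_le_quantumMaxFlow (c : β → ℕ) (𝒯 : N.TensorAssignment c) :
    (N.beta 𝒯).rank ≤ N.quantumMaxFlow c :=
  le_csSup ⟨Fintype.card (N.InputIndex c), by
    rintro _ ⟨𝒯, rfl⟩
    exact (N.beta 𝒯).rank_le_card_width⟩ ⟨𝒯, rfl⟩

/-! ### Tensors that transmit labels -/

section Labelling

variable {N} {c : β → ℕ} {k d : ℕ} [NeZero d] (hd : ∀ e ∈ N.graph.edgeSet, d ≤ c e)
  (F : Fin k → Set N.graph.edgeSet)

open Classical in
/-- The multi-index with the value `x i` on the edges in `F i` and the value `0` on the edges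
outside all of the sets `F i`. -/
noncomputable def labelIndex (x : Fin k → Fin d) : N.EdgeIndex c := fun e =>
  Fin.castLE (hd e e.2) (if h : ∃ i, e ∈ F i then x h.choose else 0)

open Classical in
/-- The tensors that permit, at each vertex, exactly the restrictions of the multi-indices
`labelIndex hd F x`. -/
noncomputable def labelTensor : N.TensorAssignment c := fun v w =>
  if ∃ x, w = readAt (labelIndex hd F x) v then 1 else 0

variable {F}

theorem val_labelIndex (hF : Pairwise fun i j => Disjoint (F i) (F j)) (x : Fin k → Fin d)
    {e : N.graph.edgeSet} {i : Fin k} (he : e ∈ F i) : (labelIndex hd F x e : ℕ) = x i := by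
  have h : ∃ i, e ∈ F i := ⟨i, he⟩
  have hi : h.choose = i := by
    by_contra hne
    exact Set.disjoint_left.1 (hF hne) h.choose_spec he
  rw [labelIndex, dif_pos h, hi, Fin.val_castLE]

theorem eq_of_readAt_eq {W W' : N.EdgeIndex c} {v : α} (h : readAt W v = readAt W' v)
    {e : N.graph.edgeSet} (he : N.graph.Inc (e : β) v) : W e = W' e :=
  congrFun h (.inl ⟨e, he⟩)

-- Entries count permitted multi-indices, so no cancellation can occur: one witness makes an entry
-- nonzero.
open Classical in
theorem beta_labelTensor (J : N.OutputIndex c) (I : N.InputIndex c) :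
    N.beta (labelTensor hd F) J I = (Finset.card {W : N.EdgeIndex c |
      ((∀ u : N.S, readAt W (u : α) = I u) ∧ ∀ u : N.T, readAt W (u : α) = J u) ∧
        ∀ v : N.internal, ∃ x, readAt W (v : α) = readAt (labelIndex hd F x) v} : ℂ) := by
  simp only [beta, labelTensor, Finset.prod_ite_zero, Finset.prod_const_one, Finset.mem_univ,
    true_imp_iff, Finset.sum_boole, Finset.filter_filter]

/-- A multi-index that is permitted by `labelTensor` and by the inputs and outputs forces the labels
at the inputs and at the outputs to agree. -/
theorem label_eq_of_readAt (hF : Pairwise fun i j => Disjoint (F i) (F j))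
    (hc : ∀ i, Connects N.EdgeAdj (F i) (N.edgesAt N.S) (N.edgesAt N.T))
    {x y : Fin k → Fin d} {W : N.EdgeIndex c}
    (hS : ∀ u : N.S, readAt W (u : α) = readAt (labelIndex hd F x) u)
    (hT : ∀ u : N.T, readAt W (u : α) = readAt (labelIndex hd F y) u)
    (hV : ∀ v : N.internal, ∃ z, readAt W (v : α) = readAt (labelIndex hd F z) v) : x = y := by
  funext i
  obtain ⟨a, ⟨s, hs, has⟩, b, ⟨t, ht, hbt⟩, hab⟩ := hc i
  have ha : (W a : ℕ) = x i := by
    rw [eq_of_readAt_eq (hS ⟨s, hs⟩) has, val_labelIndex hd hF x hab.left_mem]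
  have hb : (W b : ℕ) = y i := by
    rw [eq_of_readAt_eq (hT ⟨t, ht⟩) hbt, val_labelIndex hd hF y hab.right_mem]
  have hloc : ∀ v ∈ N.graph.vertexSet, ∃ z, readAt W v = readAt (labelIndex hd F z) v := by
    intro v hv
    by_cases hvS : v ∈ N.S
    · exact ⟨x, hS ⟨v, hvS⟩⟩
    by_cases hvT : v ∈ N.T
    · exact ⟨y, hT ⟨v, hvT⟩⟩
    · exact hV ⟨v, hv, fun h => h.elim hvS hvT⟩
  -- The pattern `z` may change from vertex to vertex, but at each vertex it gives equal labels to
  -- both edges of `F i`.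
  have hWb : (W b : ℕ) = x i := by
    refine hab.induction (p := fun e => (W e : ℕ) = x i) ha ?_
    rintro e e' he ⟨v, hev, hev'⟩ he' ih
    obtain ⟨z, hz⟩ := hloc v hev.vertex_mem
    rw [← ih, eq_of_readAt_eq hz hev, eq_of_readAt_eq hz hev', val_labelIndex hd hF z he',
      val_labelIndex hd hF z he.right_mem]
  exact Fin.ext (hWb.symm.trans hb)

theorem pow_le_rank_beta_labelTensor (hF : Pairwise fun i j => Disjoint (F i) (F j))
    (hc : ∀ i, Connects N.EdgeAdj (F i) (N.edgesAt N.S) (N.edgesAt N.T)) :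
    d ^ k ≤ (N.beta (labelTensor hd F)).rank := by
  classical
  set J : (Fin k → Fin d) → N.OutputIndex c := fun y u => readAt (labelIndex hd F y) u
  set I : (Fin k → Fin d) → N.InputIndex c := fun x u => readAt (labelIndex hd F x) u
  have hdiag : (N.beta (labelTensor hd F)).submatrix J I =
      Matrix.diagonal fun x => N.beta (labelTensor hd F) (J x) (I x) := by
    ext y x
    rw [Matrix.submatrix_apply]
    obtain rfl | hne := eq_or_ne y x
    · rw [Matrix.diagonal_apply_eq]
    · rw [Matrix.diagonal_apply_ne _ hne, beta_labelTensor, Nat.cast_eq_zero, Finset.card_eq_zero,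
        Finset.filter_eq_empty_iff]
      rintro W - ⟨⟨hS, hT⟩, hV⟩
      exact hne (label_eq_of_readAt hd hF hc hS hT hV).symm
  have hne : ∀ x, N.beta (labelTensor hd F) (J x) (I x) ≠ 0 := by
    intro x
    rw [beta_labelTensor, Nat.cast_ne_zero, Finset.card_ne_zero]
    exact ⟨labelIndex hd F x, Finset.mem_filter.2
      ⟨Finset.mem_univ _, ⟨fun _ => rfl, fun _ => rfl⟩, fun _ => ⟨x, rfl⟩⟩⟩
  calc d ^ k = ((N.beta (labelTensor hd F)).submatrix J I).rank := by
        rw [hdiag, Matrix.rank_diagonal]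
        simp [hne]
    _ ≤ _ := Matrix.rank_submatrix_le _ _ _

end Labelling

end OpenGraph

theorem proposition3p10 {α β : Type*} (N : OpenGraph α β) (c : β → ℕ)
    (hc : ∀ e ∈ N.graph.edgeSet, 0 < c e)
    (dmin : ℕ) (hd : ∀ e ∈ N.graph.edgeSet, dmin ≤ c e) :
    dmin ^ N.minCut ≤ N.quantumMaxFlow c := by
  -- Label 0 must exist even when `dmin = 0`.
  have hd' : ∀ e ∈ N.graph.edgeSet, max dmin 1 ≤ c e := fun e he => max_le (hd e he) (hc e he)
  have : NeZero (max dmin 1) := ⟨by omega⟩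
  obtain ⟨F, hF, hFc⟩ := N.exists_disjoint_edge_sets
  calc dmin ^ N.minCut ≤ max dmin 1 ^ N.minCut := Nat.pow_le_pow_left (le_max_left _ _) _
    _ ≤ (N.beta (OpenGraph.labelTensor hd' F)).rank :=
      OpenGraph.pow_le_rank_beta_labelTensor hd' hF hFc
    _ ≤ N.quantumMaxFlow c := N.rank_beta_le_quantumMaxFlow c _
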